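/- \textbf{Setting.} An extended (oblique) bi-factor model with $J$ variables and $G$ group factors is given by a partition of $\{1,\dots,J\}$ into groups $\mathcal B_1,\dots,\mathcal B_G$ and real matrices $\Lambda=(\lambda_{jk})\in\mathbb R^{J\times(G+1)}$, $\Phi=(\phi_{kk'})\in\mathbb R^{(G+1)\times(G+1)}$, $\Psi\in\mathbb R^{J\times J}$ such that $\lambda_{j,g+1}=0$ whenever $j\notin\mathcal B_g$; $\Phi$ is a strictly positive definite correlation matrix with $\phi_{1k}=0$ for all $k\ne1$; and $\Psi$ is diagonal. The covariance matrix is $\Lambda\Phi\Lambda^\top+\Psi$. Write $\mathcal Q_g=\{j\in\mathcal B_g:\lambda_{j,g+1}\neq0\}$ and let $H$ be the set of all $g$ for which the submatrix $\Lambda[\mathcal B_g,\{1,1+g\}]$ has rank $2$. \textbf{Condition 4.} $|H|\ge2$; $|\mathcal Q_g|\ge2$ for $g=1,\dots,G$; and $|\mathcal Q_g|\ge3$ for every $g$ such that $\phi_{1+g,1+g'}=0$ for all $g'\in\{1,\dots,G\}$, $g'\ne g$. \textbf{Condition 5.} $|H|\ge3$, and there are three different groups $g_1,g_2,g_3\in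 H$ such that $|\mathcal Q_{g_i}|\ge3$ for $i=1,2,3$ and any two different rows of $\Lambda[\mathcal B_{g_1},\{1,1+g_1\}]$ are linearly independent. \textbf{Theorem 2.} Let $J=24$, $G=7$. Let $\Lambda^*,\Phi^*,\Psi^*$ be parameters of an extended bi-factor model whose groups are $\mathcal B^*_1=\{1,2,3,4,7\}$, $\mathcal B^*_2=\{19,20\}$, $\mathcal B^*_3=\{21,22,23,24\}$, $\mathcal B^*_4=\{6,9,10,11,12\}$, $\mathcal B^*_5=\{13,14,15,16\}$, $\mathcal B^*_6=\{5,8\}$, $\mathcal B^*_7=\{17,18\}$ (the structure estimated in the extraversion data), where $\lambda^*_{j,g+1}\ne0$ if and only if $j\in\mathcal B^*_g$, and suppose that they satisfy Conditions 4 and 5. Let $\Lambda,\Phi,\Psi$ be any parameters of an extended bi-factor model with $24$ variables and $7$ group factors, with an arbitrary partition into groups $\mathcal B_1,\dots,\mathcal B_7$, which satisfy Condition 4 and $$\Lambda^*\Phi^*(\Lambda^*)^\top+\Psi^*=\Lambda\Phi\Lambda^\top+\Psi .$$ Then there exist a diagonal matrix $D$ with diagonal entries in $\{1,-1\}$ and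 an $8\times8$ permutation matrix $P$ with $P_{11}=1$ such that $\Lambda=\Lambda^*PD$, $\Phi=DP^\top\Phi^*PD$ and $\Psi^*=\Psi$. -/

import Mathlib

/-- The loading matrix `Λ`, the factor correlation matrix `Φ` and the unique-variance matrix `Ψ`
are parameters of an extended bi-factor model with `J` variables and `G` group factors whose
groups are the fibres `B_g = {j | b j = g}` of `b`.  Column `0` is the general factor and column
`g.succ` is the group factor `g`.  Here `Φ` is a strictly positive definite correlation matrix
in which the general factor is uncorrelated with the group factors, and `Ψ` is diagonal. -/
structure IsBifactor {J G : ℕ} (b : Fin J → Fin G) (Λ : Matrix (Fin J) (Fin (G + 1)) ℝ)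
    (Φ : Matrix (Fin (G + 1)) (Fin (G + 1)) ℝ) (Ψ : Matrix (Fin J) (Fin J) ℝ) : Prop where
  loading_eq_zero : ∀ j g, b j ≠ g → Λ j g.succ = 0
  posDef : Φ.PosDef
  diag_eq_one : ∀ k, Φ k k = 1
  general_uncorrelated : ∀ k, k ≠ 0 → Φ 0 k = 0
  isDiag : Ψ.IsDiag

/-- The block `Λ[B_g, {1, 1 + g}]`: rows in the group `g`, and the columns of the general factor
and of the group factor `g`. -/
def groupBlock {J G : ℕ} (b : Fin J → Fin G) (Λ : Matrix (Fin J) (Fin (G + 1)) ℝ) (g : Fin G) :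
    Matrix {j // b j = g} (Fin 2) ℝ :=
  Matrix.of fun j => ![Λ j 0, Λ j g.succ]

/-- `Q_g`: the variables of group `g` with a nonzero loading on the group factor `g`. -/
def groupSupport {J G : ℕ} (b : Fin J → Fin G) (Λ : Matrix (Fin J) (Fin (G + 1)) ℝ)
    (g : Fin G) : Set (Fin J) :=
  {j | b j = g ∧ Λ j g.succ ≠ 0}

/-- `H`: the groups `g` for which `Λ[B_g, {1, 1 + g}]` has column rank `2`. -/
def fullRankGroups {J G : ℕ} (b : Fin J → Fin G) (Λ : Matrix (Fin J) (Fin (G + 1)) ℝ) :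
    Set (Fin G) :=
  {g | (groupBlock b Λ g).rank = 2}

/-- The necessary condition for identifiability under a known bi-factor structure. -/
structure NecessaryCondition {J G : ℕ} (b : Fin J → Fin G)
    (Λ : Matrix (Fin J) (Fin (G + 1)) ℝ) (Φ : Matrix (Fin (G + 1)) (Fin (G + 1)) ℝ) : Prop where
  two_le_fullRank : 2 ≤ (fullRankGroups b Λ).ncard
  two_le_support : ∀ g, 2 ≤ (groupSupport b Λ g).ncard
  three_le_support : ∀ g, (∀ g', g' ≠ g → Φ g.succ g'.succ = 0) →
    3 ≤ (groupSupport b Λ g).ncard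

/-- The additional condition on the true loading matrix: three different groups of rank `2`, each
with at least three nonzero group loadings, such that in the first of them any two different rows
of the block `Λ[B_g, {1, 1 + g}]` are linearly independent. -/
def SeparationCondition {J G : ℕ} (b : Fin J → Fin G)
    (Λ : Matrix (Fin J) (Fin (G + 1)) ℝ) : Prop :=
  3 ≤ (fullRankGroups b Λ).ncard ∧
  ∃ g₁ ∈ fullRankGroups b Λ, ∃ g₂ ∈ fullRankGroups b Λ, ∃ g₃ ∈ fullRankGroups b Λ,
    g₁ ≠ g₂ ∧ g₁ ≠ g₃ ∧ g₂ ≠ g₃ ∧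
    3 ≤ (groupSupport b Λ g₁).ncard ∧
    3 ≤ (groupSupport b Λ g₂).ncard ∧
    3 ≤ (groupSupport b Λ g₃).ncard ∧
    ∀ i j : {j // b j = g₁}, i ≠ j →
      LinearIndependent ℝ ![groupBlock b Λ g₁ i, groupBlock b Λ g₁ j]

/-- The group (numbered from `0`) of each of the 24 extraversion items in the estimated loading
matrix: the groups of items are `{1, 2, 3, 4, 7}`, `{19, 20}`, `{21, 22, 23, 24}`,
`{6, 9, 10, 11, 12}`, `{13, 14, 15, 16}`, `{5, 8}` and `{17, 18}`. -/
def extraversionGroup : Fin 24 → Fin 7 :=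
  ![0, 0, 0, 0, 5, 3, 0, 5, 3, 3, 3, 3, 4, 4, 4, 4, 6, 6, 1, 1, 2, 2, 2, 2]

/-- `Λ` has the bi-factor structure of the estimated extraversion loading matrix: on the group
factors, its nonzero loadings are at exactly the same places. -/
def FollowsExtraversionStructure (Λ : Matrix (Fin 24) (Fin (7 + 1)) ℝ) : Prop :=
  ∀ j g, Λ j g.succ ≠ 0 ↔ extraversionGroup j = g

/-- Diagonal matrices with diagonal entries `1` or `-1`. -/
def signFlipMatrices (n : ℕ) : Set (Matrix (Fin n) (Fin n) ℝ) :=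
  {D | ∃ d : Fin n → ℝ, (∀ i, d i = 1 ∨ d i = -1) ∧ D = Matrix.diagonal d}

/-- Permutation matrices that fix the first coordinate (the general factor). -/
def factorPermutationMatrices (G : ℕ) : Set (Matrix (Fin (G + 1)) (Fin (G + 1)) ℝ) :=
  {P | ∃ σ : Equiv.Perm (Fin (G + 1)), P = σ.permMatrix ℝ ∧ P 0 0 = 1}

/- An entry of `ΛΦΛᵀ` is determined by the other entries in the rows and columns of an invertible
minor of maximal size, and for a variable in a group of at least three variables there is such a
minor of off-diagonal entries.  The common parts of the two models therefore agree on the large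
groups, where their factors differ by a matrix `T`.  Each row of the new loading matrix has only one
group loading, and three pairwise independent rows in one group together with an independent pair in
another then force `T` to be a signed permutation.  So the general loadings agree up to one sign
on the large groups, hence everywhere, because covariances with an independent pair determine them.
After removal of the general factor, two variables that share a group in the new model share one in
the true model, since otherwise the two group factors would be perfectly correlated.  Finally, the
covariances among two such groupmates and a variable of a correlated group determine the remaining
diagonal entries of the common part. -/

section LinearAlgebra

open Matrix

variable {ι m n l : Type*}

theorem eq_zero_of_mul_ne_mul {R : Type*} [CommRing R] [NoZeroDivisors R] {p q r s x y : R}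
    (hdet : p * s ≠ r * q) (h₁ : p * x + q * y = 0) (h₂ : r * x + s * y = 0) :
    x = 0 ∧ y = 0 := by
  have hdet' : p * s - r * q ≠ 0 := sub_ne_zero.2 hdet
  have hx : (p * s - r * q) * x = 0 := by linear_combination s * h₁ - q * h₂
  have hy : (p * s - r * q) * y = 0 := by linear_combination p * h₂ - r * h₁
  exact ⟨(mul_eq_zero.1 hx).resolve_left hdet', (mul_eq_zero.1 hy).resolve_left hdet'⟩

theorem card_le_of_linearIndependent_of_support {K : Type*} [Field K] [Fintype m] {v : m → n → K}
    (hv : LinearIndependent K v) (s : Finset n) (hs : ∀ x, ∀ k ∉ s, v x k = 0) :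
    Fintype.card m ≤ s.card := by
  have hext : Function.ExtendByZero.linearMap K ((↑) : s → n) ∘ (fun x k => v x k) = v := by
    funext x k
    change Function.extend Subtype.val (fun k : s => v x k) 0 k = v x k
    by_cases hk : k ∈ s
    · exact Subtype.val_injective.extend_apply _ _ (⟨k, hk⟩ : s)
    · rw [hs x k hk]
      exact Function.extend_apply' _ _ _ fun ⟨j, hj⟩ => hk (hj ▸ j.2)
  have hrestrict : LinearIndependent K fun x (k : s) => v x k :=
    LinearIndependent.of_comp _ (hext.symm ▸ hv)
  simpa using hrestrict.fintype_card_le_finrank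

theorem mul_eq_submatrix_mul_inv_mul_submatrix {R : Type*} [CommRing R] [Fintype n]
    [DecidableEq n] (X : Matrix m n R) (Y : Matrix n l R) {r : n → m} {s : n → l}
    (h : IsUnit ((X * Y).submatrix r s)) :
    X * Y = (X * Y).submatrix id s * ((X * Y).submatrix r s)⁻¹ * (X * Y).submatrix r id := by
  have hdet : IsUnit ((X.submatrix r id).det * (Y.submatrix id s).det) := by
    rwa [← det_mul, ← submatrix_mul _ _ _ _ _ Function.bijective_id, ← isUnit_iff_isUnit_det]
  have hX := isUnit_of_mul_isUnit_left hdet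
  have hY := isUnit_of_mul_isUnit_right hdet
  simp only [submatrix_mul _ _ _ id _ Function.bijective_id, submatrix_id_id, Matrix.mul_inv_rev]
  calc X * Y = X * (Y.submatrix id s * (Y.submatrix id s)⁻¹) *
        ((X.submatrix r id)⁻¹ * X.submatrix r id) * Y := by
        rw [mul_nonsing_inv _ hY, nonsing_inv_mul _ hX, Matrix.mul_one, Matrix.mul_one]
    _ = _ := by simp only [Matrix.mul_assoc]

theorem mul_apply_eq_of_isUnit_submatrix {R : Type*} [CommRing R] [Fintype n] [DecidableEq n]
    {X Z : Matrix m n R} {Y W : Matrix n l R} {r : n → m} {s : n → l} {i : m} {j : l}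
    (hunit : IsUnit ((X * Y).submatrix r s))
    (hrs : ∀ k k', (X * Y) (r k) (s k') = (Z * W) (r k) (s k'))
    (hi : ∀ k, (X * Y) i (s k) = (Z * W) i (s k)) (hj : ∀ k, (X * Y) (r k) j = (Z * W) (r k) j) :
    (X * Y) i j = (Z * W) i j := by
  have hsub : (X * Y).submatrix r s = (Z * W).submatrix r s := Matrix.ext hrs
  have hXY := mul_eq_submatrix_mul_inv_mul_submatrix X Y hunit
  have hZW := mul_eq_submatrix_mul_inv_mul_submatrix Z W (hsub ▸ hunit)
  generalize X * Y = A at *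
  generalize Z * W = B at *
  rw [hXY, hZW, hsub]
  simp only [mul_apply, submatrix_apply, id_eq, hi, hj]

section Ordered

variable {K : Type*} [Field K] [PartialOrder K] [StarRing K] [Fintype n]

theorem eq_zero_of_mul_mul_conjTranspose_eq_zero {E : Matrix ι n K} {Q : Matrix n n K}
    (hQ : Q.PosDef) (h : E * Q * Eᴴ = 0) : E = 0 := by
  funext i
  by_contra hi
  have hpos := hQ.dotProduct_mulVec_pos (star_ne_zero.2 hi)
  have hii : (E * Q * Eᴴ) i i = star (star (E i)) ⬝ᵥ (Q *ᵥ star (E i)) := by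
    rw [star_star, Matrix.mul_assoc, mul_apply']
    rfl
  rw [← hii, h] at hpos
  exact lt_irrefl _ hpos

theorem exists_eq_mul_of_mul_mul_conjTranspose_eq [StarOrderedRing K] [Finite ι] [Fintype m]
    {A : Matrix ι m K} {R : Matrix m m K} {B : Matrix ι n K} {Q : Matrix n n K}
    (hA : Function.Injective A.mulVec) (hQ : Q.PosDef) (h : A * R * Aᴴ = B * Q * Bᴴ) :
    ∃ T : Matrix m n K, B = A * T ∧ R = T * Q * Tᴴ := by
  classical
  have := Fintype.ofFinite ι
  obtain ⟨N, hN⟩ : ∃ N : Matrix m ι K, N * A = 1 :=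
    ⟨(Aᴴ * A)⁻¹ * Aᴴ, by
      rw [Matrix.mul_assoc, nonsing_inv_mul _
        ((isUnit_iff_isUnit_det _).1 (PosDef.conjTranspose_mul_self A hA).isUnit)]⟩
  have hN' : Aᴴ * Nᴴ = 1 := by rw [← conjTranspose_mul, hN, conjTranspose_one]
  refine ⟨N * B, ?_, ?_⟩
  · have hker : (1 - A * N) * A = 0 := by
      rw [Matrix.sub_mul, Matrix.one_mul, Matrix.mul_assoc, hN, Matrix.mul_one, sub_self]
    have hzero : (1 - A * N) * B * Q * ((1 - A * N) * B)ᴴ = 0 := by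
      calc (1 - A * N) * B * Q * ((1 - A * N) * B)ᴴ
          = (1 - A * N) * (B * Q * Bᴴ) * (1 - A * N)ᴴ := by
            simp only [conjTranspose_mul, Matrix.mul_assoc]
        _ = (1 - A * N) * A * R * Aᴴ * (1 - A * N)ᴴ := by
            simp only [← h, Matrix.mul_assoc]
        _ = 0 := by simp only [hker, Matrix.zero_mul]
    have := eq_zero_of_mul_mul_conjTranspose_eq_zero hQ hzero
    rwa [Matrix.sub_mul, Matrix.one_mul, sub_eq_zero, Matrix.mul_assoc] at this
  · calc R = N * A * R * (Aᴴ * Nᴴ) := by rw [hN, hN', Matrix.one_mul, Matrix.mul_one]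
      _ = N * (A * R * Aᴴ) * Nᴴ := by simp only [Matrix.mul_assoc]
      _ = N * B * Q * (N * B)ᴴ := by simp only [h, conjTranspose_mul, Matrix.mul_assoc]

theorem linearIndependent_row_of_posDef_mul_mul_conjTranspose [Finite m] {T : Matrix m n K}
    {Q : Matrix n n K} (h : (T * Q * Tᴴ).PosDef) : LinearIndependent K T.row := by
  classical
  have := Fintype.ofFinite m
  rw [← vecMul_injective_iff]
  intro x y hxy
  refine vecMul_injective_of_isUnit h.isUnit ?_
  simp only [← vecMul_vecMul, show x ᵥ* T = y ᵥ* T from hxy]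

end Ordered

theorem sq_ne_one_of_posDef {C : Matrix m m ℝ} (hC : C.PosDef) (hdiag : ∀ k, C k k = 1)
    {k l : m} (hkl : k ≠ l) : C k l ^ 2 ≠ 1 := by
  intro hsq
  have hinj : Function.Injective ![k, l] := by
    simpa [Function.Injective, Fin.forall_fin_two] using ⟨hkl, hkl.symm⟩
  have hsymm : C l k = C k l := hC.isHermitian.apply k l
  have hdet := (hC.submatrix hinj).det_pos
  simp only [det_fin_two, submatrix_apply, Matrix.cons_val_zero, Matrix.cons_val_one, hdiag,
    hsymm] at hdet
  linarith

theorem eq_mul_permMatrix_mul_diagonal {R : Type*} [CommSemiring R] [Fintype n] [DecidableEq n]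
    {A B : Matrix m n R} {σ : Equiv.Perm n} {e : n → R} (h : ∀ i k, B i (σ k) = e k * A i k) :
    B = A * σ.permMatrix R * diagonal (e ∘ σ.symm) := by
  ext i k
  obtain ⟨k, rfl⟩ := σ.surjective k
  rw [h, mul_diagonal, PEquiv.mul_toMatrix_toPEquiv, submatrix_apply, Function.comp_apply,
    σ.symm_apply_apply, id, mul_comm]

theorem eq_diagonal_mul_permMatrix_transpose_mul {R : Type*} [CommSemiring R] [Fintype n]
    [DecidableEq n] {A B : Matrix n n R} {σ : Equiv.Perm n} {e : n → R}
    (h : ∀ k l, B (σ k) (σ l) = e k * e l * A k l) :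
    B = diagonal (e ∘ σ.symm) * (σ.permMatrix R)ᵀ * A * σ.permMatrix R *
      diagonal (e ∘ σ.symm) := by
  refine eq_mul_permMatrix_mul_diagonal fun k l => ?_
  obtain ⟨k, rfl⟩ := σ.surjective k
  rw [h, Matrix.mul_assoc, diagonal_mul, transpose_permMatrix, PEquiv.toMatrix_toPEquiv_mul,
    submatrix_apply, Function.comp_apply, σ.symm_apply_apply]
  simp only [id_eq, Equiv.Perm.inv_def, Equiv.symm_apply_apply]
  ring

end LinearAlgebra

section Counting

variable {ι γ : Type*}

theorem exists_ne_ne_of_three_le_ncard {s : Set ι} (hs : 3 ≤ s.ncard) (i j : ι) :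
    ∃ k ∈ s, k ≠ i ∧ k ≠ j := by
  have hlt : ({i, j} : Set ι).ncard < s.ncard :=
    (Set.ncard_insert_le i {j}).trans_lt (by rwa [Set.ncard_singleton])
  simpa only [Set.mem_insert_iff, Set.mem_singleton_iff, not_or] using
    Set.exists_mem_notMem_of_ncard_lt_ncard hlt

theorem exists_disjoint_sections {g : ι → γ} {i e e' f f' : ι}
    (htwo : ∀ k, 2 ≤ (g ⁻¹' {k}).ncard) (hi : 3 ≤ (g ⁻¹' {g i}).ncard)
    (he : 3 ≤ (g ⁻¹' {g e}).ncard) (hf : 3 ≤ (g ⁻¹' {g f}).ncard) (hee' : g e = g e')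
    (hff' : g f = g f') (hef : g e ≠ g f) (hie : g i ≠ g e) (hif : g i ≠ g f) :
    ∃ r s : γ → ι, (∀ k, g (r k) = k) ∧ (∀ k, g (s k) = k) ∧ r (g e) = e' ∧ s (g f) = f' ∧
      (∀ k, r k ≠ i) ∧ (∀ k, s k ≠ i) ∧ (∀ k, r k ≠ s k) ∧ (∀ k, s k ≠ e) ∧ ∀ k, r k ≠ f := by
  have hchoice : ∀ k, ∃ x y, g x = k ∧ g y = k ∧ (g e = k → x = e') ∧ (g f = k → y = f') ∧
      x ≠ i ∧ y ≠ i ∧ x ≠ y ∧ y ≠ e ∧ x ≠ f := by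
    intro k
    by_cases hke : g e = k
    · subst hke
      obtain ⟨y, hy, hye, hye'⟩ := exists_ne_ne_of_three_le_ncard he e e'
      grind
    by_cases hkf : g f = k
    · subst hkf
      obtain ⟨x, hx, hxf, hxf'⟩ := exists_ne_ne_of_three_le_ncard hf f f'
      grind
    by_cases hki : g i = k
    · subst hki
      obtain ⟨x, hx, hxi, -⟩ := exists_ne_ne_of_three_le_ncard hi i i
      obtain ⟨y, hy, hyi, hyx⟩ := exists_ne_ne_of_three_le_ncard hi i x
      grind
    · obtain ⟨x, hx, -⟩ := Set.exists_ne_of_one_lt_ncard (htwo k) i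
      obtain ⟨y, hy, hyx⟩ := Set.exists_ne_of_one_lt_ncard (htwo k) x
      grind
  choose r s hr hs hre hsf hri hsi hrs hse hrf using hchoice
  exact ⟨r, s, hr, hs, hre _ rfl, hsf _ rfl, hri, hsi, hrs, hse, hrf⟩

end Counting

/-- The common part of a bi-factor model: the variables `ι` are partitioned into the fibres of
`group`, and variable `i` loads on the general factor by `general i` and on the factor of its own
group by `specific i`.  The general factor is uncorrelated with the group factors, whose
correlation matrix is `corr`. -/
structure BifactorModel (ι γ : Type*) where
  group : ι → γ
  general : ι → ℝ
  specific : ι → ℝ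
  corr : Matrix γ γ ℝ
  posDef : corr.PosDef
  corr_self : ∀ k, corr k k = 1

namespace BifactorModel

open Matrix

variable {ι ι' γ κ : Type*}

section Basic

/-- The contribution of the group factors to the covariances. -/
def specificCommon (M : BifactorModel ι γ) : Matrix ι ι ℝ :=
  of fun i j => M.specific i * M.specific j * M.corr (M.group i) (M.group j)

/-- The part of the covariance matrix that is explained by the factors, `ΛΦΛᵀ` in the usual
notation. -/
def common (M : BifactorModel ι γ) : Matrix ι ι ℝ :=
  of fun i j => M.general i * M.general j + M.specificCommon i j

/-- The loading matrix `Λ`; the general factor is `none`. -/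
def loading [DecidableEq γ] (M : BifactorModel ι γ) : Matrix ι (Option γ) ℝ :=
  of fun i k => k.elim (M.general i) (Pi.single (M.group i) (M.specific i))

/-- The correlation matrix `Φ` of all factors; the general factor is `none`. -/
def factorCorr (M : BifactorModel ι γ) : Matrix (Option γ) (Option γ) ℝ :=
  of fun k l => k.elim (l.elim 1 fun _ => 0) fun k => l.elim 0 (M.corr k)

/-- The model in which variable `i` is the variable `f i` of `M`. -/
def comap (M : BifactorModel ι γ) (f : ι' → ι) : BifactorModel ι' γ where
  group i := M.group (f i)
  general i := M.general (f i)
  specific i := M.specific (f i)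
  corr := M.corr
  posDef := M.posDef
  corr_self := M.corr_self

/-- The variables of the groups in `S`, with the factors of these groups only. -/
def restrict (M : BifactorModel ι γ) (S : Set γ) : BifactorModel (M.group ⁻¹' S) S where
  group i := ⟨M.group i, i.2⟩
  general i := M.general i
  specific i := M.specific i
  corr := M.corr.submatrix (↑) (↑)
  posDef := M.posDef.submatrix Subtype.val_injective
  corr_self k := M.corr_self k

/-- Two variables of one group whose rows of the loading matrix are linearly independent. -/
def IndepPair (M : BifactorModel ι γ) (i j : ι) : Prop :=
  M.group i = M.group j ∧ M.general i * M.specific j ≠ M.general j * M.specific i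

/-- The groups with at least three variables. -/
def largeGroups (M : BifactorModel ι γ) : Set γ :=
  {k | 3 ≤ (M.group ⁻¹' {k}).ncard}

/-- `N` arises from `M` by flipping the signs of factors, with `c` for the general factor and `d`
for the group factors, and by renaming the group factors along `p`. -/
structure IsSignedRelabeling (M : BifactorModel ι γ) (N : BifactorModel ι κ) (c : ℝ) (d : γ → ℝ)
    (p : γ → κ) : Prop where
  general_sign_sq : c ^ 2 = 1
  specific_sign_sq : ∀ k, d k ^ 2 = 1
  injective : Function.Injective p
  group_eq : ∀ i, N.group i = p (M.group i)
  general_eq : ∀ i, N.general i = c * M.general i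
  specific_eq : ∀ i, N.specific i = d (M.group i) * M.specific i
  corr_eq : ∀ k l, N.corr (p k) (p l) = d k * d l * M.corr k l

theorem IndepPair.restrict {M : BifactorModel ι γ} {i j : ι} (h : M.IndepPair i j) {S : Set γ}
    (hi : M.group i ∈ S) :
    (M.restrict S).IndepPair ⟨i, hi⟩ ⟨j, Set.mem_preimage.2 (h.1 ▸ hi)⟩ :=
  ⟨Subtype.ext h.1, h.2⟩

theorem IndepPair.of_restrict {M : BifactorModel ι γ} {S : Set γ} {i j : M.group ⁻¹' S}
    (h : (M.restrict S).IndepPair i j) : M.IndepPair i j :=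
  ⟨congrArg Subtype.val h.1, h.2⟩

theorem common_apply (M : BifactorModel ι γ) (i j : ι) : M.common i j =
    M.general i * M.general j + M.specific i * M.specific j * M.corr (M.group i) (M.group j) :=
  rfl

theorem specificCommon_apply (M : BifactorModel ι γ) (i j : ι) : M.specificCommon i j =
    M.specific i * M.specific j * M.corr (M.group i) (M.group j) :=
  rfl

theorem corr_comm (M : BifactorModel ι γ) (k l : γ) : M.corr k l = M.corr l k :=
  M.posDef.isHermitian.apply l k

theorem factorCorr_posDef [Finite γ] (M : BifactorModel ι γ) : M.factorCorr.PosDef := by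
  have := Fintype.ofFinite γ
  refine PosDef.of_dotProduct_mulVec_pos (IsHermitian.ext ?_) fun x hx => ?_
  · rintro (_ | k) (_ | l)
    · exact star_one ℝ
    · exact star_zero ℝ
    · exact star_zero ℝ
    · exact M.posDef.isHermitian.apply k l
  have hsplit : star x ⬝ᵥ (M.factorCorr *ᵥ x) = x none ^ 2 +
      star (x ∘ some) ⬝ᵥ (M.corr *ᵥ (x ∘ some)) := by
    simp [dotProduct, mulVec, Fintype.sum_option, factorCorr, sq]
  rw [hsplit]
  by_cases hsome : x ∘ some = 0
  · have hnone : x none ≠ 0 := fun h => hx (funext fun k => k.casesOn h (congrFun hsome))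
    simp only [hsome, mulVec_zero, dotProduct_zero, add_zero]
    positivity
  · exact add_pos_of_nonneg_of_pos (sq_nonneg _) (M.posDef.dotProduct_mulVec_pos hsome)

variable [Fintype γ] [DecidableEq γ]

theorem loading_mulVec (M : BifactorModel ι γ) (x : Option γ → ℝ) (i : ι) :
    (M.loading *ᵥ x) i = M.general i * x none + M.specific i * x (some (M.group i)) := by
  simp [mulVec, dotProduct, Fintype.sum_option, loading, Pi.single_apply]

theorem loading_mul_apply (M : BifactorModel ι γ) (T : Matrix (Option γ) ι' ℝ) (i : ι) (k : ι') :
    (M.loading * T) i k = M.general i * T none k + M.specific i * T (some (M.group i)) k :=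
  M.loading_mulVec (T.col k) i

theorem common_eq (M : BifactorModel ι γ) :
    M.common = M.loading * M.factorCorr * M.loadingᴴ := by
  ext i j
  rw [Matrix.mul_assoc, loading_mul_apply]
  simp only [common_apply, factorCorr, loading, conjTranspose_eq_transpose_of_trivial, mul_apply,
    of_apply, Option.elim_none, transpose_apply, Fintype.sum_option, one_mul, Option.elim_some,
    Pi.single_apply, mul_ite, zero_mul, mul_zero, ite_self, Finset.sum_const_zero, add_zero,
    Finset.sum_ite_eq', Finset.mem_univ, ↓reduceIte, zero_add]
  ring

theorem loading_mulVec_injective {M : BifactorModel ι γ} (hsurj : Function.Surjective M.group)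
    (hspec : ∀ i, M.specific i ≠ 0) {i j : ι} (hij : M.IndepPair i j) :
    Function.Injective M.loading.mulVec := by
  rw [← coe_mulVecLin, ← LinearMap.ker_eq_bot, LinearMap.ker_eq_bot']
  intro x hx
  have hrow : ∀ i, M.general i * x none + M.specific i * x (some (M.group i)) = 0 := fun i => by
    rw [← loading_mulVec]
    exact congrFun hx i
  have hnone : x none = 0 := (eq_zero_of_mul_ne_mul hij.2 (hrow i) (hij.1 ▸ hrow j)).1
  funext k
  cases k with
  | none => exact hnone
  | some k =>
    obtain ⟨l, rfl⟩ := hsurj k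
    have hl := hrow l
    rw [hnone, mul_zero, zero_add] at hl
    exact (mul_eq_zero.1 hl).resolve_left (hspec l)

theorem isUnit_loading_submatrix {M : BifactorModel ι γ} (hspec : ∀ i, M.specific i ≠ 0)
    {r : γ → ι} (hr : ∀ k, M.group (r k) = k) {e : ι} (he : M.IndepPair e (r (M.group e))) :
    IsUnit (M.loading.submatrix (fun k : Option γ => k.elim e r) id) :=
  mulVec_injective_iff_isUnit.1 <|
    loading_mulVec_injective (M := M.comap fun k : Option γ => k.elim e r) (i := none)
      (j := some (M.group e)) (fun k => ⟨some k, hr k⟩) (fun _ => hspec _) he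

end Basic

section Rotation

variable [Fintype γ] [DecidableEq γ] [Fintype κ] [DecidableEq κ]

/-- The change of factors `T` takes the loadings and factor correlations of `M` to those of `N`.
Models with the same common part are compared through such a `T`. -/
structure IsRotation (M : BifactorModel ι γ) (N : BifactorModel ι κ)
    (T : Matrix (Option γ) (Option κ) ℝ) : Prop where
  loading_eq : N.loading = M.loading * T
  factorCorr_eq : M.factorCorr = T * N.factorCorr * Tᴴ

theorem exists_isRotation [Finite ι] {M : BifactorModel ι γ} {N : BifactorModel ι κ}
    (hsurj : Function.Surjective M.group) (hspec : ∀ i, M.specific i ≠ 0) {i j : ι}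
    (hij : M.IndepPair i j) (hcommon : M.common = N.common) : ∃ T, IsRotation M N T := by
  obtain ⟨T, hload, hcorr⟩ := exists_eq_mul_of_mul_mul_conjTranspose_eq
    (loading_mulVec_injective hsurj hspec hij) N.factorCorr_posDef
    (by rw [← common_eq, ← common_eq, hcommon])
  exact ⟨T, hload, hcorr⟩

namespace IsRotation

variable {M : BifactorModel ι γ} {N : BifactorModel ι κ} {T : Matrix (Option γ) (Option κ) ℝ}

theorem general_eq (hT : IsRotation M N T) (i : ι) : N.general i =
    M.general i * T none none + M.specific i * T (some (M.group i)) none := by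
  rw [← loading_mul_apply, ← hT.loading_eq]
  rfl

theorem single_eq (hT : IsRotation M N T) (i : ι) (k : κ) :
    (Pi.single (N.group i) (N.specific i) : κ → ℝ) k =
      M.general i * T none (some k) + M.specific i * T (some (M.group i)) (some k) := by
  rw [← loading_mul_apply, ← hT.loading_eq]
  rfl

theorem add_eq_zero (hT : IsRotation M N T) {i : ι} {k : κ} (hk : k ≠ N.group i) :
    M.general i * T none (some k) + M.specific i * T (some (M.group i)) (some k) = 0 := by
  rw [← hT.single_eq, Pi.single_eq_of_ne hk]

theorem eq_zero_of_indepPair (hT : IsRotation M N T) {i j : ι} (hij : M.IndepPair i j) {k : κ}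
    (hi : k ≠ N.group i) (hj : k ≠ N.group j) :
    T none (some k) = 0 ∧ T (some (M.group i)) (some k) = 0 :=
  eq_zero_of_mul_ne_mul hij.2 (hT.add_eq_zero hi) (hij.1 ▸ hT.add_eq_zero hj)

theorem linearIndependent_row (hT : IsRotation M N T) : LinearIndependent ℝ T.row :=
  linearIndependent_row_of_posDef_mul_mul_conjTranspose (hT.factorCorr_eq ▸ M.factorCorr_posDef)

/-- Every group of `N`, with at most one exception, is avoided by two of the three variables. -/
theorem exists_forall_ne_eq_zero (hT : IsRotation M N T) {i₁ i₂ i₃ : ι}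
    (h₁₂ : M.IndepPair i₁ i₂) (h₁₃ : M.IndepPair i₁ i₃) (h₂₃ : M.IndepPair i₂ i₃) :
    ∃ h, ∀ k ≠ h, T none (some k) = 0 ∧ T (some (M.group i₁)) (some k) = 0 := by
  by_cases hb : N.group i₁ = N.group i₂
  · exact ⟨N.group i₁, fun k hk => hT.eq_zero_of_indepPair h₁₂ hk (hb ▸ hk)⟩
  refine ⟨N.group i₃, fun k hk => ?_⟩
  by_cases hk₁ : k = N.group i₁
  · rw [h₁₂.1]
    exact hT.eq_zero_of_indepPair h₂₃ (hk₁ ▸ hb) hk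
  · exact hT.eq_zero_of_indepPair h₁₃ hk₁ hk

theorem none_some_eq_zero (hT : IsRotation M N T) (hspec : ∀ i, M.specific i ≠ 0)
    {i₁ i₂ i₃ j₁ j₂ : ι} (h₁₂ : M.IndepPair i₁ i₂) (h₁₃ : M.IndepPair i₁ i₃)
    (h₂₃ : M.IndepPair i₂ i₃) (hj : M.IndepPair j₁ j₂) (hij : M.group i₁ ≠ M.group j₁) (k : κ) :
    T none (some k) = 0 := by
  obtain ⟨h, hh⟩ := hT.exists_forall_ne_eq_zero h₁₂ h₁₃ h₂₃
  by_cases hk : k = h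
  swap
  · exact (hh k hk).1
  subst hk
  by_cases hb : k ≠ N.group j₁ ∧ k ≠ N.group j₂
  · exact (hT.eq_zero_of_indepPair hj hb.1 hb.2).1
  obtain ⟨j, hjM, hjN⟩ : ∃ j, M.group j = M.group j₁ ∧ N.group j = k := by grind [hj.1]
  -- The rows `none`, `M.group i₁` and `M.group j` would be supported on two columns.
  let rows : Fin 3 → Option γ := ![none, some (M.group i₁), some (M.group j)]
  have hrows : Function.Injective rows := by
    intro x y
    fin_cases x <;> fin_cases y <;> simp [rows, hjM, hij, hij.symm]
  have hsupp : ∀ x, ∀ l ∉ ({none, some k} : Finset (Option κ)), T (rows x) l = 0 := by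
    intro x l hl
    obtain ⟨l, rfl⟩ : ∃ m, l = some m := Option.ne_none_iff_exists'.1 (by grind)
    have hlk : l ≠ k := by grind
    have hrow := hT.add_eq_zero (hjN ▸ hlk)
    rw [(hh l hlk).1, mul_zero, zero_add] at hrow
    fin_cases x
    · exact (hh l hlk).1
    · exact (hh l hlk).2
    · exact (mul_eq_zero.1 hrow).resolve_left (hspec j)
  have hcard := card_le_of_linearIndependent_of_support
    (hT.linearIndependent_row.comp rows hrows) _ hsupp
  have := hcard.trans Finset.card_le_two
  simp at this

theorem factorCorr_apply (hT : IsRotation M N T) (k l : Option γ) : M.factorCorr k l =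
    T k none * T l none + ∑ x, ∑ y, T k (some x) * T l (some y) * N.corr x y := by
  rw [hT.factorCorr_eq, Matrix.mul_assoc, mul_apply, Fintype.sum_option]
  simp only [mul_apply, Fintype.sum_option, factorCorr, of_apply, Option.elim_none,
    Option.elim_some, conjTranspose_eq_transpose_of_trivial, transpose_apply, one_mul, zero_mul,
    Finset.sum_const_zero, add_zero, zero_add, Finset.mul_sum]
  simp only [mul_assoc, mul_comm (N.corr _ _)]

theorem none_none_sq (hT : IsRotation M N T) (hzero : ∀ k, T none (some k) = 0) :
    T none none ^ 2 = 1 := by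
  have h := hT.factorCorr_apply none none
  simp only [factorCorr, of_apply, Option.elim_none, hzero, zero_mul, Finset.sum_const_zero,
    add_zero] at h
  rw [sq, h]

theorem some_none_eq_zero (hT : IsRotation M N T) (hzero : ∀ k, T none (some k) = 0) (k : γ) :
    T (some k) none = 0 := by
  have h := hT.factorCorr_apply none (some k)
  simp only [factorCorr, of_apply, Option.elim_none, Option.elim_some, hzero, zero_mul,
    Finset.sum_const_zero, add_zero] at h
  refine (mul_eq_zero.1 h.symm).resolve_left fun hnone => ?_
  simpa [hnone] using hT.none_none_sq hzero

theorem some_some_eq_zero (hT : IsRotation M N T) (hspec : ∀ i, M.specific i ≠ 0)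
    (hzero : ∀ k, T none (some k) = 0) {i : ι} {k : κ} (hk : k ≠ N.group i) :
    T (some (M.group i)) (some k) = 0 := by
  have h := hT.add_eq_zero hk
  rw [hzero, mul_zero, zero_add] at h
  exact (mul_eq_zero.1 h).resolve_left (hspec i)

theorem corr_eq (hT : IsRotation M N T) (hspec : ∀ i, M.specific i ≠ 0)
    (hzero : ∀ k, T none (some k) = 0) (i j : ι) : M.corr (M.group i) (M.group j) =
      T (some (M.group i)) (some (N.group i)) * T (some (M.group j)) (some (N.group j)) *
        N.corr (N.group i) (N.group j) := by
  have hsome : ∀ {i k}, k ≠ N.group i → T (some (M.group i)) (some k) = 0 :=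
    hT.some_some_eq_zero hspec hzero
  have h : M.corr _ _ = _ := hT.factorCorr_apply (some (M.group i)) (some (M.group j))
  rwa [hT.some_none_eq_zero hzero, zero_mul, zero_add,
    Finset.sum_eq_single_of_mem (N.group i) (Finset.mem_univ _)
      (fun x _ hx => by simp only [hsome hx, zero_mul, Finset.sum_const_zero]),
    Finset.sum_eq_single_of_mem (N.group j) (Finset.mem_univ _)
      (fun y _ hy => by simp only [hsome hy, mul_zero, zero_mul])] at h

theorem group_eq_of_group_eq (hT : IsRotation M N T) (hspec : ∀ i, M.specific i ≠ 0)
    (hzero : ∀ k, T none (some k) = 0) {i j : ι} (hij : M.group i = M.group j) :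
    N.group i = N.group j := by
  by_contra hne
  have h := hT.corr_eq hspec hzero i i
  rw [M.corr_self, hij, hT.some_some_eq_zero hspec hzero hne] at h
  simp at h

theorem isSignedRelabeling (hT : IsRotation M N T) (hspec : ∀ i, M.specific i ≠ 0)
    (hzero : ∀ k, T none (some k) = 0) {r : γ → ι} (hr : ∀ k, M.group (r k) = k) :
    IsSignedRelabeling M N (T none none) (fun k => T (some k) (some (N.group (r k))))
      fun k => N.group (r k) := by
  have hgroup : ∀ i, N.group i = N.group (r (M.group i)) := fun i =>
    hT.group_eq_of_group_eq hspec hzero (hr _).symm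
  have hcorr : ∀ k l, M.corr k l = T (some k) (some (N.group (r k))) *
      T (some l) (some (N.group (r l))) * N.corr (N.group (r k)) (N.group (r l)) := fun k l => by
    simpa only [hr] using hT.corr_eq hspec hzero (r k) (r l)
  have hsign : ∀ k, T (some k) (some (N.group (r k))) ^ 2 = 1 := fun k => by
    rw [sq, ← M.corr_self k, hcorr k k, N.corr_self, mul_one]
  refine ⟨hT.none_none_sq hzero, hsign, fun k l hkl => ?_, hgroup, fun i => ?_, fun i => ?_,
    fun k l => ?_⟩
  · by_contra hne
    refine sq_ne_one_of_posDef M.posDef M.corr_self hne ?_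
    rw [hcorr, show N.group (r k) = N.group (r l) from hkl, N.corr_self, mul_one, mul_pow, hsign,
      mul_one, ← hkl, hsign]
  · rw [hT.general_eq, hT.some_none_eq_zero hzero, mul_zero, add_zero, mul_comm]
  · have h := hT.single_eq i (N.group i)
    rwa [Pi.single_eq_same, hzero, mul_zero, zero_add, hgroup i, mul_comm] at h
  · rw [hcorr k l]
    linear_combination -N.corr (N.group (r k)) (N.group (r l)) *
      (T (some l) (some (N.group (r l))) ^ 2 * hsign k + hsign l)

end IsRotation

end Rotation

theorem exists_isSignedRelabeling_of_common_eq [Finite ι] [Finite γ] [Finite κ]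
    {M : BifactorModel ι γ} {N : BifactorModel ι κ} (hsurj : Function.Surjective M.group)
    (hspec : ∀ i, M.specific i ≠ 0) {i₁ i₂ i₃ j₁ j₂ : ι} (h₁₂ : M.IndepPair i₁ i₂)
    (h₁₃ : M.IndepPair i₁ i₃) (h₂₃ : M.IndepPair i₂ i₃) (hj : M.IndepPair j₁ j₂)
    (hij : M.group i₁ ≠ M.group j₁) (hcommon : M.common = N.common) :
    ∃ c d p, IsSignedRelabeling M N c d p := by
  classical
  have := Fintype.ofFinite γ
  have := Fintype.ofFinite κ
  obtain ⟨T, hT⟩ := exists_isRotation hsurj hspec h₁₂ hcommon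
  choose r hr using hsurj
  exact ⟨_, _, _, hT.isSignedRelabeling hspec
    (hT.none_some_eq_zero hspec h₁₂ h₁₃ h₂₃ hj hij) hr⟩

section Communality

variable {M : BifactorModel ι γ} {N : BifactorModel ι κ}

theorem common_self_eq_of_indepPair [Finite γ] {N : BifactorModel ι γ}
    (hspec : ∀ i, M.specific i ≠ 0) (htwo : ∀ k, 2 ≤ (M.group ⁻¹' {k}).ncard)
    (hoff : ∀ i j, i ≠ j → M.common i j = N.common i j) {i e e' f f' : ι}
    (hi : M.group i ∈ M.largeGroups) (he : M.group e ∈ M.largeGroups)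
    (hf : M.group f ∈ M.largeGroups) (hee' : M.IndepPair e e') (hff' : M.IndepPair f f')
    (hef : M.group e ≠ M.group f) (hie : M.group i ≠ M.group e) (hif : M.group i ≠ M.group f) :
    M.common i i = N.common i i := by
  classical
  have := Fintype.ofFinite γ
  obtain ⟨r, s, hr, hs, hre, hsf, hri, hsi, hrs, hse, hrf⟩ :=
    exists_disjoint_sections htwo hi he hf hee'.1 hff'.1 hef hie hif
  let R : Option γ → ι := fun k => k.elim e r
  let S : Option γ → ι := fun k => k.elim f s
  have hR : ∀ k, R k ≠ i := by rintro (_ | k) <;> grind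
  have hS : ∀ k, S k ≠ i := by rintro (_ | k) <;> grind
  have hRS : ∀ k l, R k ≠ S l := by rintro (_ | k) (_ | l) <;> grind
  have hunit : IsUnit ((M.loading * (M.factorCorr * M.loadingᴴ)).submatrix R S) := by
    rw [submatrix_mul _ _ _ id _ Function.bijective_id,
      submatrix_mul _ _ id id _ Function.bijective_id]
    exact (isUnit_loading_submatrix hspec hr (hre ▸ hee')).mul <|
      M.factorCorr_posDef.isUnit.mul <| (isUnit_conjTranspose _).2 <|
        isUnit_loading_submatrix hspec hs (hsf ▸ hff')
  have hM : M.common = M.loading * (M.factorCorr * M.loadingᴴ) := by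
    rw [common_eq, Matrix.mul_assoc]
  have hN : N.common = N.loading * (N.factorCorr * N.loadingᴴ) := by
    rw [common_eq, Matrix.mul_assoc]
  rw [hM, hN] at hoff ⊢
  exact mul_apply_eq_of_isUnit_submatrix hunit (fun k l => hoff _ _ (hRS k l))
    (fun k => hoff _ _ (hS k).symm) fun k => hoff _ _ (hR k)

theorem IsSignedRelabeling.general_eq_of_indepPair {S : Set γ} {c : ℝ} {d : S → ℝ} {p : S → κ}
    (hrel : IsSignedRelabeling (M.restrict S) (N.comap (↑)) c d p) {i₁ i₂ : M.group ⁻¹' S}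
    (hi : (M.restrict S).IndepPair i₁ i₂) {j : ι} (h₁ : M.common i₁ j = N.common i₁ j)
    (h₂ : M.common i₂ j = N.common i₂ j) : N.general j = c * M.general j := by
  have hM : M.IndepPair i₁ i₂ := hi.of_restrict
  have hN : N.group i₂ = N.group i₁ :=
    (hrel.group_eq i₂).trans ((congrArg p hi.1.symm).trans (hrel.group_eq i₁).symm)
  have hgen : ∀ i : M.group ⁻¹' S, N.general i = c * M.general i := hrel.general_eq
  have hspec₁ : N.specific i₁ = _ * M.specific i₁ := hrel.specific_eq i₁
  have hspec₂ : N.specific i₂ = _ * M.specific i₂ := hrel.specific_eq i₂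
  rw [common_apply, common_apply, hgen, hspec₁] at h₁
  rw [common_apply, common_apply, hgen, hspec₂, ← hi.1, ← hM.1, hN] at h₂
  have hzero := (eq_zero_of_mul_ne_mul (x := M.general j - c * N.general j)
    (y := M.specific j * M.corr (M.group i₁) (M.group j) -
      d ((M.restrict S).group i₁) * N.specific j * N.corr (N.group i₁) (N.group j)) hM.2
    (by linear_combination h₁) (by linear_combination h₂)).1
  linear_combination -c * hzero - N.general j * hrel.general_sign_sq

theorem specificCommon_eq_iff {c : ℝ} (hc : c ^ 2 = 1)
    (hgen : ∀ i, N.general i = c * M.general i) {i j : ι} :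
    M.specificCommon i j = N.specificCommon i j ↔ M.common i j = N.common i j := by
  have hprod : N.general i * N.general j = M.general i * M.general j := by
    rw [hgen, hgen]
    linear_combination M.general i * M.general j * hc
  simp only [common, of_apply, hprod, add_right_inj]

/-- Otherwise the factors of the two groups would be perfectly correlated. -/
theorem group_eq_of_groupmate (hspec : ∀ i, M.specific i ≠ 0)
    (hoff : ∀ i j, i ≠ j → M.specificCommon i j = N.specificCommon i j) {i j k l : ι}
    (hij : i ≠ j) (hkl : k ≠ l) (hj : M.group j = M.group i) (hl : M.group l = M.group k)
    (hik : N.group k = N.group i) : M.group k = M.group i := by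
  by_contra hne
  refine sq_ne_one_of_posDef M.posDef M.corr_self hne (sub_eq_zero.1 ?_)
  have hprod : M.specific i * M.specific j * (M.specific k * M.specific l) ≠ 0 :=
    mul_ne_zero (mul_ne_zero (hspec i) (hspec j)) (mul_ne_zero (hspec k) (hspec l))
  refine (mul_eq_zero.1 ?_).resolve_left hprod
  have h_ij := hoff i j hij
  have h_kl := hoff k l hkl
  have h_il := hoff i l (by grind)
  have h_kj := hoff k j (by grind)
  simp only [specificCommon_apply, hj, hl, hik, M.corr_self, mul_one] at h_ij h_kl h_il h_kj
  rw [M.corr_comm (M.group i)] at h_il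
  linear_combination M.specific j * M.specific k * M.corr (M.group k) (M.group i) * h_il +
    N.specific i * N.specific l * N.corr (N.group i) (N.group l) * h_kj -
    M.specific k * M.specific l * h_ij -
    N.specific i * N.specific j * N.corr (N.group i) (N.group j) * h_kl

theorem specificCommon_self_eq_of_partner (hspec : ∀ i, M.specific i ≠ 0)
    (hoff : ∀ i j, i ≠ j → M.specificCommon i j = N.specificCommon i j) {i j k : ι}
    (hij : i ≠ j) (hM : M.group j = M.group i) (hN : N.group j = N.group i)
    (hk : M.group k ≠ M.group i) (hcorr : M.corr (M.group i) (M.group k) ≠ 0) :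
    M.specificCommon i i = N.specificCommon i i := by
  have h_ij := hoff i j hij
  have h_ik := hoff i k (by grind)
  have h_jk := hoff j k (by grind)
  simp only [specificCommon_apply, hM, hN, M.corr_self, N.corr_self, mul_one] at h_ij h_ik h_jk ⊢
  have hcross : M.specific i * N.specific j = M.specific j * N.specific i := by
    refine mul_left_cancel₀ (mul_ne_zero (hspec k) hcorr) ?_
    linear_combination N.specific j * h_ik - N.specific i * h_jk
  refine mul_left_cancel₀ (hspec j) ?_
  linear_combination M.specific i * h_ij + N.specific i * hcross

end Communality

section Identifiability

variable {M : BifactorModel ι γ} {N : BifactorModel ι κ}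

theorem common_self_eq_of_mem_largeGroups [Finite γ] {N : BifactorModel ι γ}
    (hspec : ∀ i, M.specific i ≠ 0) (htwo : ∀ k, 2 ≤ (M.group ⁻¹' {k}).ncard)
    (hoff : ∀ i j, i ≠ j → M.common i j = N.common i j)
    {e e' f f' h h' : M.group ⁻¹' M.largeGroups}
    (hee' : (M.restrict M.largeGroups).IndepPair e e')
    (hff' : (M.restrict M.largeGroups).IndepPair f f')
    (hhh' : (M.restrict M.largeGroups).IndepPair h h')
    (hef : M.group e ≠ M.group f) (heh : M.group e ≠ M.group h) (hfh : M.group f ≠ M.group h)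
    (i : M.group ⁻¹' M.largeGroups) : M.common i i = N.common i i := by
  by_cases hie : M.group i = M.group e
  · exact common_self_eq_of_indepPair hspec htwo hoff i.2 f.2 h.2 hff'.of_restrict
      hhh'.of_restrict hfh (hie ▸ hef) (hie ▸ heh)
  by_cases hif : M.group i = M.group f
  · exact common_self_eq_of_indepPair hspec htwo hoff i.2 e.2 h.2 hee'.of_restrict
      hhh'.of_restrict heh hie (hif ▸ hfh)
  · exact common_self_eq_of_indepPair hspec htwo hoff i.2 e.2 f.2 hee'.of_restrict
      hff'.of_restrict hef hie hif

theorem exists_general_eq_mul [Finite ι] [Finite γ] [Finite κ] (hspec : ∀ i, M.specific i ≠ 0)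
    (hoff : ∀ i j, i ≠ j → M.common i j = N.common i j)
    (hself : ∀ i : M.group ⁻¹' M.largeGroups, M.common i i = N.common i i)
    {i₁ i₂ i₃ j₁ j₂ : M.group ⁻¹' M.largeGroups}
    (h₁₂ : (M.restrict M.largeGroups).IndepPair i₁ i₂)
    (h₁₃ : (M.restrict M.largeGroups).IndepPair i₁ i₃)
    (h₂₃ : (M.restrict M.largeGroups).IndepPair i₂ i₃)
    (hj : (M.restrict M.largeGroups).IndepPair j₁ j₂) (hij : M.group i₁ ≠ M.group j₁) :
    ∃ c, c ^ 2 = 1 ∧ ∀ i, N.general i = c * M.general i := by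
  have hsurj : Function.Surjective (M.restrict M.largeGroups).group := by
    rintro ⟨k, hk⟩
    obtain ⟨i, rfl⟩ := Set.nonempty_of_ncard_ne_zero (Nat.ne_of_gt (three_pos.trans_le hk))
    exact ⟨⟨i, hk⟩, rfl⟩
  have hcommon : (M.restrict M.largeGroups).common = (N.comap (↑)).common := by
    ext i j
    by_cases h : i = j
    · exact h ▸ hself i
    · exact hoff i j (Subtype.coe_injective.ne h)
  obtain ⟨c, d, p, hrel⟩ := exists_isSignedRelabeling_of_common_eq hsurj (fun i => hspec i)
    h₁₂ h₁₃ h₂₃ hj (fun h => hij (congrArg Subtype.val h)) hcommon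
  refine ⟨c, hrel.general_sign_sq, fun i => ?_⟩
  by_cases hlarge : M.group i ∈ M.largeGroups
  · exact hrel.general_eq ⟨i, hlarge⟩
  have hne : ∀ j : M.group ⁻¹' M.largeGroups, (j : ι) ≠ i := fun j h => hlarge (h ▸ j.2)
  exact hrel.general_eq_of_indepPair h₁₂ (hoff _ _ (hne i₁)) (hoff _ _ (hne i₂))

theorem exists_partner (hspec : ∀ i, M.specific i ≠ 0)
    (hM : ∀ k, 2 ≤ (M.group ⁻¹' {k}).ncard) (hN : ∀ k, 2 ≤ (N.group ⁻¹' {k}).ncard)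
    (hoff : ∀ i j, i ≠ j → M.specificCommon i j = N.specificCommon i j) (i : ι) :
    ∃ j, i ≠ j ∧ M.group j = M.group i ∧ N.group j = N.group i := by
  obtain ⟨j, hj, hji⟩ := Set.exists_ne_of_one_lt_ncard (hN (N.group i)) i
  obtain ⟨i', hi', hii'⟩ := Set.exists_ne_of_one_lt_ncard (hM (M.group i)) i
  obtain ⟨j', hj', hjj'⟩ := Set.exists_ne_of_one_lt_ncard (hM (M.group j)) j
  exact ⟨j, hji.symm, group_eq_of_groupmate hspec hoff hii'.symm hjj'.symm hi' hj' hj, hj⟩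

theorem common_eq_of_forall_ne [Finite ι] [Finite γ] {N : BifactorModel ι γ}
    (hspec : ∀ i, M.specific i ≠ 0)
    (hM : ∀ k, 2 ≤ (M.group ⁻¹' {k}).ncard) (hN : ∀ k, 2 ≤ (N.group ⁻¹' {k}).ncard)
    (hlarge : ∀ k, (∀ l, l ≠ k → M.corr k l = 0) → k ∈ M.largeGroups)
    {i₁ i₂ i₃ j₁ j₂ k₁ k₂ : M.group ⁻¹' M.largeGroups}
    (h₁₂ : (M.restrict M.largeGroups).IndepPair i₁ i₂)
    (h₁₃ : (M.restrict M.largeGroups).IndepPair i₁ i₃)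
    (h₂₃ : (M.restrict M.largeGroups).IndepPair i₂ i₃)
    (hj : (M.restrict M.largeGroups).IndepPair j₁ j₂)
    (hk : (M.restrict M.largeGroups).IndepPair k₁ k₂) (hij : M.group i₁ ≠ M.group j₁)
    (hik : M.group i₁ ≠ M.group k₁) (hjk : M.group j₁ ≠ M.group k₁)
    (hoff : ∀ i j, i ≠ j → M.common i j = N.common i j) : M.common = N.common := by
  have hself := common_self_eq_of_mem_largeGroups hspec hM hoff h₁₂ hj hk hij hik hjk
  obtain ⟨c, hc, hgen⟩ := exists_general_eq_mul hspec hoff hself h₁₂ h₁₃ h₂₃ hj hij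
  have hoff' : ∀ i j, i ≠ j → M.specificCommon i j = N.specificCommon i j := fun i j h =>
    (specificCommon_eq_iff hc hgen).2 (hoff i j h)
  ext i j
  by_cases hne : i ≠ j
  · exact hoff i j hne
  obtain rfl := not_not.1 hne
  by_cases hi : M.group i ∈ M.largeGroups
  · exact hself ⟨i, hi⟩
  obtain ⟨l, hl, hcorr⟩ : ∃ l, l ≠ M.group i ∧ M.corr (M.group i) l ≠ 0 := by
    contrapose! hi
    exact hlarge _ hi
  obtain ⟨k, rfl⟩ := Set.nonempty_of_ncard_ne_zero (Nat.ne_of_gt (two_pos.trans_le (hM l)))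
  obtain ⟨j, hij, hMj, hNj⟩ := exists_partner hspec hM hN hoff' i
  exact (specificCommon_eq_iff hc hgen).1
    (specificCommon_self_eq_of_partner hspec hoff' hij hMj hNj hl hcorr)

end Identifiability

end BifactorModel

section Transfer

open Matrix

variable {J G : ℕ} {bs b : Fin J → Fin G} {Λs Λ : Matrix (Fin J) (Fin (G + 1)) ℝ}
  {Φs Φ : Matrix (Fin (G + 1)) (Fin (G + 1)) ℝ} {Ψs Ψ : Matrix (Fin J) (Fin J) ℝ}

namespace IsBifactor

/-- The model with the given parameters, without the unique variances `Ψ`. -/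
def toModel (h : IsBifactor b Λ Φ Ψ) : BifactorModel (Fin J) (Fin G) where
  group := b
  general i := Λ i 0
  specific i := Λ i (b i).succ
  corr := Φ.submatrix Fin.succ Fin.succ
  posDef := h.posDef.submatrix (Fin.succ_injective G)
  corr_self _ := h.diag_eq_one _

theorem corr_zero_succ (h : IsBifactor b Λ Φ Ψ) (k : Fin G) : Φ 0 k.succ = 0 :=
  h.general_uncorrelated _ (Fin.succ_ne_zero k)

theorem corr_succ_zero (h : IsBifactor b Λ Φ Ψ) (k : Fin G) : Φ k.succ 0 = 0 := by
  rw [← h.posDef.isHermitian.apply, h.corr_zero_succ, star_zero]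

theorem mul_mul_transpose_eq_common (h : IsBifactor b Λ Φ Ψ) : Λ * Φ * Λᵀ = h.toModel.common := by
  have hsum : ∀ (i : Fin J) (f : Fin G → ℝ),
      ∑ k : Fin G, Λ i k.succ * f k = Λ i (b i).succ * f (b i) := fun i f =>
    Finset.sum_eq_single_of_mem _ (Finset.mem_univ _) fun k _ hk => by
      rw [h.loading_eq_zero i k hk.symm, zero_mul]
  ext i j
  rw [BifactorModel.common_apply, Matrix.mul_assoc]
  simp only [mul_apply, transpose_apply, Fin.sum_univ_succ, h.corr_zero_succ, h.corr_succ_zero,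
    h.diag_eq_one, hsum, mul_comm (Φ _ _), toModel, submatrix_apply]
  ring

theorem common_eq_of_ne (hs : IsBifactor bs Λs Φs Ψs) (h : IsBifactor b Λ Φ Ψ)
    (hcov : Λs * Φs * Λsᵀ + Ψs = Λ * Φ * Λᵀ + Ψ) (i j : Fin J) (hij : i ≠ j) :
    hs.toModel.common i j = h.toModel.common i j := by
  rw [← mul_mul_transpose_eq_common, ← mul_mul_transpose_eq_common]
  simpa only [Matrix.add_apply, hs.isDiag hij, h.isDiag hij, add_zero] using congrFun₂ hcov i j

theorem exists_indepPair (h : IsBifactor b Λ Φ Ψ) (hspec : ∀ i, Λ i (b i).succ ≠ 0) {g : Fin G}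
    (hg : g ∈ fullRankGroups b Λ) : ∃ i j, b i = g ∧ h.toModel.IndepPair i j := by
  by_contra! hall
  have hminor : ∀ i j, b i = g → b j = g → Λ i 0 * Λ j g.succ = Λ j 0 * Λ i g.succ := by
    rintro i j rfl hj
    by_contra hne
    exact hall i j rfl ⟨hj.symm, by simpa only [toModel, hj] using hne⟩
  have hblock : ∃ c : ℝ, groupBlock b Λ g =
      vecMulVec (fun i : {j // b j = g} => Λ i g.succ) ![c, 1] := by
    rcases isEmpty_or_nonempty {j // b j = g} with hempty | ⟨⟨i, hi⟩⟩
    · exact ⟨0, Subsingleton.elim _ _⟩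
    refine ⟨Λ i 0 / Λ i g.succ, ext fun j k => ?_⟩
    have hi₀ : Λ i g.succ ≠ 0 := hi ▸ hspec i
    fin_cases k
    · simp only [groupBlock, of_apply, vecMulVec_apply, Fin.zero_eta, cons_val_zero]
      field_simp
      linear_combination hminor j i j.2 hi
    · simp [groupBlock, vecMulVec_apply]
  obtain ⟨c, hc⟩ := hblock
  have hrank := rank_vecMulVec_le (fun i : {j // b j = g} => Λ i g.succ) ![c, 1]
  rw [← hc, show (groupBlock b Λ g).rank = 2 from hg] at hrank
  omega

theorem indepPair_of_linearIndependent (h : IsBifactor b Λ Φ Ψ) {g : Fin G} {i j : {j // b j = g}}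
    (hij : LinearIndependent ℝ ![groupBlock b Λ g i, groupBlock b Λ g j]) :
    h.toModel.IndepPair i j := by
  have hrow : LinearIndependent ℝ (of ![groupBlock b Λ g i, groupBlock b Λ g j]).row := hij
  rw [linearIndependent_rows_iff_isUnit, isUnit_iff_isUnit_det, det_fin_two,
    isUnit_iff_ne_zero, sub_ne_zero] at hrow
  refine ⟨i.2.trans j.2.symm, ?_⟩
  simpa [toModel, groupBlock, i.2, j.2, mul_comm (Λ j 0)] using hrow

theorem ncard_groupSupport_le (h : IsBifactor b Λ Φ Ψ) (g : Fin G) :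
    (groupSupport b Λ g).ncard ≤ (h.toModel.group ⁻¹' {g}).ncard :=
  Set.ncard_le_ncard fun _ hj => hj.1

end IsBifactor

theorem exists_perm_succ_eq {p : Fin G → Fin G} (hp : Function.Injective p) :
    ∃ σ : Equiv.Perm (Fin (G + 1)), σ 0 = 0 ∧ ∀ k : Fin G, σ k.succ = (p k).succ :=
  ⟨Equiv.Perm.decomposeFin.symm (0, .ofBijective p (Finite.injective_iff_bijective.1 hp)),
    by simp, fun k => by simp⟩

theorem exists_signFlip_permutation (hs : IsBifactor bs Λs Φs Ψs) (h : IsBifactor b Λ Φ Ψ)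
    {c : ℝ} {d : Fin G → ℝ} {p : Fin G → Fin G}
    (hrel : hs.toModel.IsSignedRelabeling h.toModel c d p) :
    ∃ D ∈ signFlipMatrices (G + 1), ∃ P ∈ factorPermutationMatrices G,
      Λ = Λs * P * D ∧ Φ = D * Pᵀ * Φs * P * D := by
  obtain ⟨σ, hσ₀, hσ⟩ := exists_perm_succ_eq hrel.injective
  let e : Fin (G + 1) → ℝ := Fin.cons c d
  have he : ∀ k, e k ^ 2 = 1 := Fin.cases hrel.general_sign_sq hrel.specific_sign_sq
  refine ⟨diagonal (e ∘ σ.symm), ⟨_, fun k => sq_eq_one_iff.1 (he _), rfl⟩,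
    σ.permMatrix ℝ, ⟨σ, rfl, ?_⟩, eq_mul_permMatrix_mul_diagonal ?_,
    eq_diagonal_mul_permMatrix_transpose_mul ?_⟩
  · simp [Equiv.toPEquiv_apply, PEquiv.toMatrix_apply, hσ₀]
  · intro i k
    cases k using Fin.cases with
    | zero => rw [hσ₀]; exact hrel.general_eq i
    | succ k =>
      rw [hσ]
      by_cases hk : bs i = k
      · subst hk
        exact hrel.group_eq i ▸ hrel.specific_eq i
      · rw [h.loading_eq_zero, hs.loading_eq_zero i k hk, mul_zero]
        exact fun hb => hk (hrel.injective ((hrel.group_eq i).symm.trans hb))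
  · intro k l
    cases k using Fin.cases with
    | zero =>
      cases l using Fin.cases with
      | zero => rw [hσ₀, h.diag_eq_one, hs.diag_eq_one, mul_one, ← sq, he]
      | succ l => rw [hσ₀, hσ, h.corr_zero_succ, hs.corr_zero_succ, mul_zero]
    | succ k =>
      cases l using Fin.cases with
      | zero => rw [hσ₀, hσ, h.corr_succ_zero, hs.corr_succ_zero, mul_zero]
      | succ l => rw [hσ, hσ]; exact hrel.corr_eq k l

end Transfer

open Matrix in
theorem theorem2_general {J G : ℕ} {bs b : Fin J → Fin G} {Λs Λ : Matrix (Fin J) (Fin (G + 1)) ℝ}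
    {Φs Φ : Matrix (Fin (G + 1)) (Fin (G + 1)) ℝ} {Ψs Ψ : Matrix (Fin J) (Fin J) ℝ}
    (hs : IsBifactor bs Λs Φs Ψs) (hspec : ∀ i, Λs i (bs i).succ ≠ 0)
    (hnec : NecessaryCondition bs Λs Φs) (hsep : SeparationCondition bs Λs)
    (h : IsBifactor b Λ Φ Ψ) (hgroup : ∀ g, 2 ≤ (b ⁻¹' {g}).ncard)
    (hcov : Λs * Φs * Λsᵀ + Ψs = Λ * Φ * Λᵀ + Ψ) :
    ∃ D ∈ signFlipMatrices (G + 1), ∃ P ∈ factorPermutationMatrices G,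
      Λ = Λs * P * D ∧ Φ = D * Pᵀ * Φs * P * D ∧ Ψs = Ψ := by
  obtain ⟨-, g₁, hg₁, g₂, hg₂, g₃, hg₃, h₁₂, h₁₃, h₂₃, hQ₁, hQ₂, hQ₃, hindep⟩ := hsep
  have htwo : ∀ g, 2 ≤ (bs ⁻¹' {g}).ncard := fun g =>
    (hnec.two_le_support g).trans (hs.ncard_groupSupport_le g)
  have hlarge : ∀ {g}, 3 ≤ (groupSupport bs Λs g).ncard → g ∈ hs.toModel.largeGroups := fun hQ =>
    hQ.trans (hs.ncard_groupSupport_le _)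
  obtain ⟨i₁, i₂, rfl, hi₁₂⟩ := hs.exists_indepPair hspec hg₁
  obtain ⟨j₁, j₂, rfl, hj⟩ := hs.exists_indepPair hspec hg₂
  obtain ⟨k₁, k₂, rfl, hk⟩ := hs.exists_indepPair hspec hg₃
  obtain ⟨i₃, hi₃, hi₃₁, hi₃₂⟩ := exists_ne_ne_of_three_le_ncard (hlarge hQ₁) i₁ i₂
  have hpair : ∀ i, bs i = bs i₁ → i₃ ≠ i → hs.toModel.IndepPair i i₃ := fun i hi hne =>
    hs.indepPair_of_linearIndependent (hindep ⟨i, hi⟩ ⟨i₃, hi₃⟩ (Subtype.coe_ne_coe.1 hne.symm))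
  have hi₁₃ := hpair i₁ rfl hi₃₁
  have hi₂₃ := hpair i₂ hi₁₂.1.symm hi₃₂
  have hi₂ : hs.toModel.group i₂ ∈ hs.toModel.largeGroups := hi₁₂.1 ▸ hlarge hQ₁
  have hcommon : hs.toModel.common = h.toModel.common :=
    BifactorModel.common_eq_of_forall_ne hspec htwo hgroup
      (fun g hg => hlarge (hnec.three_le_support g hg)) (hi₁₂.restrict (hlarge hQ₁))
      (hi₁₃.restrict (hlarge hQ₁)) (hi₂₃.restrict hi₂) (hj.restrict (hlarge hQ₂))
      (hk.restrict (hlarge hQ₃)) h₁₂ h₁₃ h₂₃ (hs.common_eq_of_ne h hcov)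
  obtain ⟨c, d, p, hrel⟩ := BifactorModel.exists_isSignedRelabeling_of_common_eq
    (fun g => Set.nonempty_of_ncard_ne_zero (Nat.ne_of_gt (two_pos.trans_le (htwo g))))
    hspec hi₁₂ hi₁₃ hi₂₃ hj h₁₂ hcommon
  obtain ⟨D, hD, P, hP, hΛ, hΦ⟩ := exists_signFlip_permutation hs h hrel
  rw [hs.mul_mul_transpose_eq_common, h.mul_mul_transpose_eq_common, hcommon] at hcov
  exact ⟨D, hD, P, hP, hΛ, hΦ, add_left_cancel hcov⟩

open Matrix in
theorem theorem2
    (Λs : Matrix (Fin 24) (Fin (7 + 1)) ℝ) (Φs : Matrix (Fin (7 + 1)) (Fin (7 + 1)) ℝ)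
    (Ψs : Matrix (Fin 24) (Fin 24) ℝ)
    (hs : IsBifactor extraversionGroup Λs Φs Ψs)
    (hstruct : FollowsExtraversionStructure Λs)
    (hnec : NecessaryCondition extraversionGroup Λs Φs)
    (hsep : SeparationCondition extraversionGroup Λs)
    (b : Fin 24 → Fin 7)
    (Λ : Matrix (Fin 24) (Fin (7 + 1)) ℝ) (Φ : Matrix (Fin (7 + 1)) (Fin (7 + 1)) ℝ)
    (Ψ : Matrix (Fin 24) (Fin 24) ℝ)
    (h : IsBifactor b Λ Φ Ψ)
    (hnec' : NecessaryCondition b Λ Φ)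
    (hcov : Λs * Φs * Λsᵀ + Ψs = Λ * Φ * Λᵀ + Ψ) :
    ∃ D ∈ signFlipMatrices (7 + 1), ∃ P ∈ factorPermutationMatrices 7,
      Λ = Λs * P * D ∧ Φ = D * Pᵀ * Φs * P * D ∧ Ψs = Ψ :=
  theorem2_general hs (fun j => (hstruct j _).2 rfl) hnec hsep h
    (fun g => (hnec'.two_le_support g).trans (h.ncard_groupSupport_le g)) hcov
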